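/- Let $V$ be a finite-dimensional real vector space, and let $\mathcal{K}(V)$ be the set of convex bodies (nonempty compact convex subsets) of $V$, with the topology of the Hausdorff metric induced by any norm on $V$. A function $\varphi\colon\mathcal{K}(V)\to A$ into an abelian group $A$ is called a valuation if $\varphi(B\cup C)=\varphi(B)+\varphi(C)-\varphi(B\cap C)$ for all $B,C\in\mathcal{K}(V)$ with $B\cup C\in\mathcal{K}(V)$, and translation-invariant if $\varphi(x+K)=\varphi(K)$ for all $x\in V$ and $K\in\mathcal{K}(V)$. Let $\varphi\colon\mathcal{K}(V)\to A$ be a continuous translation-invariant valuation with values in a Hausdorff topological abelian group $A$. Then $\varphi$ takes the same value $c\in A$ on all one-point convex bodies, and there are a real Hausdorff topological vector space $\mathcal{V}$, a continuous translation-invariant valuation $f\colon\mathcal{K}(V)\to\mathcal{V}$ and a continuous group homomorphism $g\colon\mathcal{V}\to A$ such that \[ \varphi(X)-c=g(f(X))\qquad\text{for all }X\in\mathcal{K}(V). \] -/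

import Mathlib

universe u v

namespace ConvexBody

variable {V : Type*} [TopologicalSpace V] [AddCommGroup V] [Module ℝ V]

/-- The one-point convex body `{x}`. -/
def point (x : V) : ConvexBody V where
  carrier := {x}
  convex' := convex_singleton x
  isCompact' := isCompact_singleton
  nonempty' := Set.singleton_nonempty x

/-- The translate `x + K` of a convex body `K`. -/
def translate [ContinuousAdd V] (x : V) (K : ConvexBody V) : ConvexBody V where
  carrier := (fun y => x + y) '' (K : Set V)
  convex' := K.convex.translate x
  isCompact' := K.isCompact.image (continuous_const.add continuous_id)
  nonempty' := K.nonempty.image _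

/-- A function `φ` on convex bodies with values in an abelian group is a valuation if
`φ (B ∪ C) = φ B + φ C - φ (B ∩ C)` whenever `B`, `C` and `B ∪ C` are convex bodies. Here `U` is
the convex body `B ∪ C` and `I` is the convex body `B ∩ C`; the latter always exists in a Hausdorff
space, because a convex set is connected and so is not the union of two disjoint nonempty
compact sets. -/
def IsValuation {A : Type*} [AddCommGroup A] (φ : ConvexBody V → A) : Prop :=
  ∀ B C U I : ConvexBody V, (U : Set V) = (B : Set V) ∪ (C : Set V) →
    (I : Set V) = (B : Set V) ∩ (C : Set V) → φ U = φ B + φ C - φ I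

/-- `φ (x + K) = φ K` for every vector `x` and every convex body `K`. -/
def IsTranslationInvariant [ContinuousAdd V] {A : Type*} (φ : ConvexBody V → A) : Prop :=
  ∀ (x : V) (K : ConvexBody V), φ (translate x K) = φ K

end ConvexBody

/-!
A convex body is a limit of polytopes, and an affine relation between more than `dim V + 1` points
decomposes their convex hull into hulls of fewer points. So a continuous valuation is determined by
its values on simplices. Slicing a dilated simplex shows that `t ↦ φ (t X)` is polynomial of degree
at most `dim V` when `X` is a simplex, hence for every `X`.

A continuous polynomial map `F` on the half-line with values in `A` need not have coefficients, but
its leading term is `γ (t ^ m / m!)` for a one-parameter group `γ : ℝ → A`, and `γ` depends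
continuously and additively on `F`. Subtracting leading terms one after the other exhibits
`F 1 - F 0` as the value at `1` of such a one-parameter group. For `F t = φ (t X)` this is
`φ X - φ {0}`, and the one-parameter groups of `A` form a real topological vector space.
-/

open Module Set fwdDiff
open scoped NNReal Pointwise Topology

section SetValuation

variable {V V' A : Type*} [AddCommGroup V] [Module ℝ V] [TopologicalSpace V] [AddCommGroup V']
  [Module ℝ V'] [TopologicalSpace V'] [AddCommGroup A]

/-- A valuation as a set function that vanishes on the empty set. Its values off the compact convex
sets are irrelevant; allowing the empty set makes restriction to a closed convex set an operation on
valuations. -/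
structure IsSetValuation (θ : Set V → A) : Prop where
  empty : θ ∅ = 0
  union : ∀ ⦃B C : Set V⦄, Convex ℝ B → Convex ℝ C → IsCompact B → IsCompact C →
    Convex ℝ (B ∪ C) → θ (B ∪ C) = θ B + θ C - θ (B ∩ C)

theorem inter_nonempty_of_convex_union [IsTopologicalAddGroup V] [ContinuousSMul ℝ V]
    {B C : Set V} (hB : B.Nonempty) (hC : C.Nonempty) (hBc : IsClosed B) (hCc : IsClosed C)
    (h : Convex ℝ (B ∪ C)) : (B ∩ C).Nonempty := by
  have := isPreconnected_closed_iff.1 h.isPreconnected B C hBc hCc subset_rfl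
    (by simpa using hB.mono (by simp)) (by simpa using hC.mono (by simp))
  exact this.mono inter_subset_right

theorem image_inter_of_convex_union [IsTopologicalAddGroup V'] [ContinuousSMul ℝ V'] [T1Space V]
    (L : V' →L[ℝ] V) {B C : Set V'} (hB : IsClosed B) (hC : IsClosed C)
    (h : Convex ℝ (B ∪ C)) : L '' (B ∩ C) = L '' B ∩ L '' C := by
  refine (image_inter_subset _ _ _).antisymm ?_
  rintro _ ⟨⟨b, hb, rfl⟩, c, hc, hbc⟩
  -- The fibre of `L` through `b` and `c` meets `B ∪ C` in a convex set.
  have hF : IsClosed (L ⁻¹' {L b}) := isClosed_singleton.preimage L.continuous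
  have hconv : Convex ℝ ((B ∩ L ⁻¹' {L b}) ∪ (C ∩ L ⁻¹' {L b})) := by
    rw [← union_inter_distrib_right]
    exact h.inter ((convex_singleton _).linear_preimage L.toLinearMap)
  obtain ⟨z, ⟨hzB, hz⟩, hzC, -⟩ :=
    inter_nonempty_of_convex_union (B := B ∩ L ⁻¹' {L b}) (C := C ∩ L ⁻¹' {L b})
      ⟨b, hb, rfl⟩ ⟨c, hc, hbc⟩ (hB.inter hF) (hC.inter hF) hconv
  exact ⟨z, ⟨hzB, hzC⟩, hz⟩

namespace IsSetValuation

variable {θ : Set V → A}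

theorem image [IsTopologicalAddGroup V'] [ContinuousSMul ℝ V'] [T2Space V'] [T1Space V]
    (hθ : IsSetValuation θ) (L : V' →L[ℝ] V) : IsSetValuation fun K => θ (L '' K) where
  empty := by rw [image_empty, hθ.empty]
  union B C hB hC hBc hCc h := by
    have hLc {K : Set V'} (hK : Convex ℝ K) : Convex ℝ (L '' K) := hK.linear_image L.toLinearMap
    rw [image_inter_of_convex_union L hBc.isClosed hCc.isClosed h, image_union]
    exact hθ.union (hLc hB) (hLc hC) (hBc.image L.continuous) (hCc.image L.continuous)
      (image_union L B C ▸ hLc h)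

theorem restrict (hθ : IsSetValuation θ) {S : Set V} (hS : Convex ℝ S) (hSc : IsClosed S) :
    IsSetValuation fun K => θ (K ∩ S) where
  empty := by rw [empty_inter, hθ.empty]
  union B C hB hC hBc hCc h := by
    rw [union_inter_distrib_right, inter_inter_distrib_right]
    exact hθ.union (hB.inter hS) (hC.inter hS) (hBc.inter_right hSc) (hCc.inter_right hSc)
      (union_inter_distrib_right B C S ▸ h.inter hS)

theorem sub {η : Set V → A} (hθ : IsSetValuation θ) (hη : IsSetValuation η) :
    IsSetValuation (θ - η) where
  empty := by rw [Pi.sub_apply, hθ.empty, hη.empty, sub_zero]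
  union B C hB hC hBc hCc h := by
    simp only [Pi.sub_apply, hθ.union hB hC hBc hCc h, hη.union hB hC hBc hCc h]
    abel

theorem cut (hθ : IsSetValuation θ) (g : V →L[ℝ] ℝ) (c : ℝ) {K : Set V} (hK : Convex ℝ K)
    (hKc : IsCompact K) :
    θ K = θ (K ∩ {x | g x ≤ c}) + θ (K ∩ {x | c ≤ g x}) - θ (K ∩ {x | g x = c}) := by
  have hunion : K ∩ {x | g x ≤ c} ∪ K ∩ {x | c ≤ g x} = K := by
    rw [← inter_union_distrib_left]
    exact inter_eq_left.2 fun x _ => le_total (g x) c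
  have hinter : K ∩ {x | g x ≤ c} ∩ (K ∩ {x | c ≤ g x}) = K ∩ {x | g x = c} := by
    rw [← inter_inter_distrib_left]
    exact congrArg (K ∩ ·) (ext fun x => (le_antisymm_iff (a := g x)).symm)
  have hcut := hθ.union (hK.inter (convex_halfSpace_le ⟨map_add g, map_smul g⟩ c))
    (hK.inter (convex_halfSpace_ge ⟨map_add g, map_smul g⟩ c))
    (hKc.inter_right (isClosed_le g.continuous continuous_const))
    (hKc.inter_right (isClosed_le continuous_const g.continuous)) (hunion.symm ▸ hK)
  rwa [hunion, hinter] at hcut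

end IsSetValuation

end SetValuation

section Minimizers

variable {ι V A : Type*} [AddCommGroup V] [Module ℝ V] [TopologicalSpace V] [AddCommGroup A]

/-- The set of points at which each `f i` with `i ∈ I` is minimal among the `f j` with `j ∈ T`. -/
def minimizerSet (f : ι → V →L[ℝ] ℝ) (I T : Finset ι) : Set V :=
  {x | ∀ i ∈ I, ∀ j ∈ T, f i x ≤ f j x}

variable {f : ι → V →L[ℝ] ℝ} {I T : Finset ι}

theorem convex_minimizerSet : Convex ℝ (minimizerSet f I T) := by
  simp only [minimizerSet, ofPred_forall]
  refine convex_iInter₂ fun i _ => convex_iInter₂ fun j _ => ?_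
  simpa only [sub_apply, sub_nonneg] using
    convex_halfSpace_ge ⟨map_add (f j - f i), map_smul (f j - f i)⟩ 0

theorem isClosed_minimizerSet : IsClosed (minimizerSet f I T) := by
  simp only [minimizerSet, ofPred_forall]
  exact isClosed_biInter fun i _ => isClosed_biInter fun j _ =>
    isClosed_le (f i).continuous (f j).continuous

section Insert

variable [DecidableEq ι] {a j : ι}

theorem minimizerSet_inter_le (ha : a ∈ I) (hI : I ⊆ T) :
    minimizerSet f I T ∩ {x | (f j - f a) x ≤ 0} =
      minimizerSet f I T ∩ minimizerSet f {j} (insert j T) := by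
  ext x
  simp only [minimizerSet, mem_inter_iff, mem_ofPred_eq, sub_apply, sub_nonpos,
    Finset.forall_mem_insert, Finset.mem_singleton, forall_eq]
  exact and_congr_right fun h =>
    ⟨fun hja => ⟨le_rfl, fun i hi => hja.trans (h a ha i hi)⟩, fun hj => hj.2 a (hI ha)⟩

theorem minimizerSet_inter_ge (ha : a ∈ I) (hI : I ⊆ T) :
    minimizerSet f I T ∩ {x | 0 ≤ (f j - f a) x} = minimizerSet f I (insert j T) := by
  ext x
  simp only [minimizerSet, mem_inter_iff, mem_ofPred_eq, sub_apply, sub_nonneg,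
    Finset.forall_mem_insert]
  exact ⟨fun h i hi => ⟨(h.1 i hi a (hI ha)).trans h.2, h.1 i hi⟩,
    fun h => ⟨fun i hi => (h i hi).2, (h a ha).1⟩⟩

theorem minimizerSet_inter_eq (ha : a ∈ I) (hI : I ⊆ T) :
    minimizerSet f I T ∩ {x | (f j - f a) x = 0} = minimizerSet f (insert j I) (insert j T) := by
  have hsplit : {x | (f j - f a) x = 0} = {x | (f j - f a) x ≤ 0} ∩ {x | 0 ≤ (f j - f a) x} :=
    ext fun x => le_antisymm_iff
  rw [hsplit, inter_inter_distrib_left, minimizerSet_inter_le ha hI, minimizerSet_inter_ge ha hI]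
  ext x
  simp only [minimizerSet, mem_inter_iff, mem_ofPred_eq, Finset.forall_mem_insert,
    Finset.mem_singleton, forall_eq]
  exact ⟨fun h => ⟨h.1.2, h.2⟩, fun h => ⟨⟨fun i hi => (h.2 i hi).2, h.1⟩, h.2⟩⟩

end Insert

/-- Inclusion-exclusion over the cells of the covering of `K` by the sets on which a given `f i` is
minimal. -/
theorem IsSetValuation.eq_zero_of_minimizerSet {θ : Set V → A} (hθ : IsSetValuation θ)
    (hT : T.Nonempty) {K : Set V} (hK : Convex ℝ K) (hKc : IsCompact K)
    (h : ∀ I ⊆ T, I.Nonempty → θ (K ∩ minimizerSet f I T) = 0) : θ K = 0 := by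
  classical
  induction hT using Finset.Nonempty.cons_induction generalizing θ with
  | singleton j =>
    have huniv : minimizerSet f {j} {j} = univ := by simp [minimizerSet]
    simpa only [huniv, inter_univ] using h {j} subset_rfl (Finset.singleton_nonempty j)
  | cons j T _ _ ih =>
    rw [Finset.cons_eq_insert] at h
    set J := minimizerSet f {j} (insert j T)
    have hJ : θ (K ∩ J) = 0 := h {j} (by simp) (Finset.singleton_nonempty j)
    have hη : IsSetValuation (θ - fun K => θ (K ∩ J)) :=
      hθ.sub (hθ.restrict convex_minimizerSet isClosed_minimizerSet)
    have hηK : (θ - fun K => θ (K ∩ J)) K = 0 := by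
      refine ih hη fun I hI ⟨a, ha⟩ => ?_
      have hcut := hθ.cut (f j - f a) 0 (hK.inter (convex_minimizerSet (f := f) (I := I) (T := T)))
        (hKc.inter_right isClosed_minimizerSet)
      simp only [inter_assoc, minimizerSet_inter_le ha hI, minimizerSet_inter_ge ha hI,
        minimizerSet_inter_eq ha hI] at hcut
      rw [h I (hI.trans (Finset.subset_insert j T)) ⟨a, ha⟩,
        h (insert j I) (Finset.insert_subset_insert j hI) (Finset.insert_nonempty j I)] at hcut
      rw [Pi.sub_apply, hcut, inter_assoc, add_zero, sub_zero, sub_self]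
    rwa [Pi.sub_apply, hJ, sub_zero] at hηK

end Minimizers

section AffineDependence

variable {ι V A : Type*} [AddCommGroup V] [Module ℝ V] [AddCommGroup A]

/-- The functional `a ↦ a i / k i`, the time at which the `i`-th coordinate of `a` vanishes when `a`
moves with velocity `-k`. -/
noncomputable def coordDiv (k : ι → ℝ) (i : ι) : (ι → ℝ) →L[ℝ] ℝ :=
  (k i)⁻¹ • ContinuousLinearMap.proj i

theorem coordDiv_apply (k a : ι → ℝ) (i : ι) : coordDiv k i a = a i / k i :=
  (div_eq_inv_mul _ _).symm

variable [Fintype ι]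

theorem linearCombination_image_stdSimplex (w : ι → V) :
    Fintype.linearCombination ℝ w '' stdSimplex ℝ ι = convexHull ℝ (range w) := by
  classical
  rw [← convexHull_basis_eq_stdSimplex, LinearMap.image_convexHull, ← range_comp]
  congr 2
  funext i
  simp [Fintype.linearCombination_apply, ite_smul]

theorem linearCombination_coe_image_stdSimplex (s : Finset V) :
    Fintype.linearCombination ℝ ((↑) : s → V) '' stdSimplex ℝ s = convexHull ℝ s := by
  rw [linearCombination_image_stdSimplex, Subtype.range_coe]

variable {w : ι → V} {k : ι → ℝ} {I T : Finset ι}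

theorem exists_sub_smul_mem_stdSimplex (hk : ∑ i, k i = 0) (hI : I.Nonempty) (hIT : I ⊆ T)
    (hT : ∀ i, i ∈ T ↔ 0 < k i) {a : ι → ℝ}
    (ha : a ∈ stdSimplex ℝ ι ∩ minimizerSet (coordDiv k) I T) :
    ∃ s : ℝ, a - s • k ∈ stdSimplex ℝ ι ∧ ∀ i ∈ I, (a - s • k) i = 0 := by
  obtain ⟨⟨ha0, ha1⟩, hmin⟩ := ha
  simp only [minimizerSet, mem_ofPred_eq, coordDiv_apply] at hmin
  obtain ⟨i₀, hi₀⟩ := hI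
  have hpos {i : ι} (hi : i ∈ I) : 0 < k i := (hT i).1 (hIT hi)
  refine ⟨a i₀ / k i₀, ⟨fun i => sub_nonneg.2 ?_, ?_⟩, fun i hi => sub_eq_zero.2 ?_⟩
  · rcases le_or_gt (k i) 0 with hki | hki
    · exact (mul_nonpos_of_nonneg_of_nonpos (div_nonneg (ha0 i₀) (hpos hi₀).le) hki).trans (ha0 i)
    · exact (le_div_iff₀ hki).1 (hmin i₀ hi₀ i ((hT i).2 hki))
  · simp only [Pi.sub_apply, Pi.smul_apply, smul_eq_mul, Finset.sum_sub_distrib, ← Finset.mul_sum,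
      hk, ha1, mul_zero, sub_zero]
  · have hratio : a i / k i = a i₀ / k i₀ :=
      le_antisymm (hmin i hi i₀ (hIT hi₀)) (hmin i₀ hi₀ i (hIT hi))
    exact (div_eq_iff (hpos hi).ne').1 hratio

theorem image_stdSimplex_inter_minimizerSet (hkw : ∑ i, k i • w i = 0) (hk : ∑ i, k i = 0)
    (hI : I.Nonempty) (hIT : I ⊆ T) (hT : ∀ i, i ∈ T ↔ 0 < k i) :
    Fintype.linearCombination ℝ w '' (stdSimplex ℝ ι ∩ minimizerSet (coordDiv k) I T) =
      convexHull ℝ (w '' {i | i ∉ I}) := by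
  classical
  apply subset_antisymm
  · rintro _ ⟨a, ha, rfl⟩
    obtain ⟨s, ⟨hb0, hb1⟩, hbI⟩ := exists_sub_smul_mem_stdSimplex hk hI hIT hT ha
    set b := a - s • k with hb
    have himage : Fintype.linearCombination ℝ w a = ∑ i, b i • w i := by
      rw [← Fintype.linearCombination_apply, hb, map_sub, map_smul,
        Fintype.linearCombination_apply ℝ w k, hkw, smul_zero, sub_zero]
    have hbI' : ∀ i ∈ Finset.univ, i ∉ Iᶜ → b i = 0 := fun i _ hi => hbI i (by simpa using hi)
    rw [himage, ← Finset.sum_subset (Finset.subset_univ Iᶜ)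
      fun i hu hi => by rw [hbI' i hu hi, zero_smul]]
    refine (convex_convexHull ℝ _).sum_mem (fun i _ => hb0 i) ?_
      fun i hi => subset_convexHull ℝ _ ⟨i, Finset.mem_compl.1 hi, rfl⟩
    rw [← hb1]
    exact Finset.sum_subset (Finset.subset_univ Iᶜ) hbI'
  · refine convexHull_min ?_ (((convex_stdSimplex ℝ ι).inter convex_minimizerSet).linear_image _)
    rintro _ ⟨j, hj, rfl⟩
    refine ⟨Pi.single j 1, ⟨single_mem_stdSimplex ℝ j, fun i hi l hl => ?_⟩, by
      simp [Fintype.linearCombination_apply_single]⟩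
    rw [coordDiv_apply, coordDiv_apply, Pi.single_eq_of_ne (ne_of_mem_of_not_mem hi hj), zero_div]
    exact div_nonneg ((single_mem_stdSimplex ℝ j).1 l) ((hT l).1 hl).le

/-- An affine relation between more than `dim V + 1` points decomposes their convex hull, as in the
proof of Radon's theorem, into minimizer sets that are convex hulls of fewer points. -/
theorem IsSetValuation.convexHull_eq_zero [TopologicalSpace V] [IsTopologicalAddGroup V]
    [ContinuousSMul ℝ V] [T1Space V] [FiniteDimensional ℝ V] {θ : Set V → A}
    (hθ : IsSetValuation θ)
    (h : ∀ s : Finset V, s.card ≤ finrank ℝ V + 1 → θ (convexHull ℝ s) = 0) (s : Finset V) :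
    θ (convexHull ℝ s) = 0 := by
  classical
  induction hn : s.card using Nat.strong_induction_on generalizing s with | _ n ih =>
  rcases le_or_gt s.card (finrank ℝ V + 1) with hs | hs
  · exact h s hs
  obtain ⟨k, hkw, hk, x, hxs, hx⟩ := exists_nontrivial_relation_sum_zero_of_finrank_succ_lt_card hs
  let c : s → ℝ := fun i => k i
  let T : Finset s := {i | 0 < c i}
  have hT (i : s) : i ∈ T ↔ 0 < c i := by simp [T]
  have hTne : T.Nonempty := by
    obtain ⟨i, hi, hki⟩ := Finset.exists_pos_of_sum_zero_of_exists_nonzero k hk ⟨x, hxs, hx⟩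
    exact ⟨⟨i, hi⟩, (hT _).2 hki⟩
  rw [← Finset.sum_coe_sort] at hkw hk
  let L := LinearMap.toContinuousLinearMap (Fintype.linearCombination ℝ ((↑) : s → V))
  have hL : L '' stdSimplex ℝ s = convexHull ℝ s := linearCombination_coe_image_stdSimplex s
  rw [← hL]
  refine (hθ.image L).eq_zero_of_minimizerSet (f := coordDiv c) hTne (convex_stdSimplex ℝ s)
    (isCompact_stdSimplex ℝ s) fun I hI hIne => ?_
  have hface : L '' (stdSimplex ℝ s ∩ minimizerSet (coordDiv c) I T) =
      convexHull ℝ (Iᶜ.image ((↑) : s → V)) := by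
    rw [Finset.coe_image, Finset.coe_compl]
    exact image_stdSimplex_inter_minimizerSet hkw hk hIne hI hT
  have hcard : (Iᶜ.image ((↑) : s → V)).card < n := by
    rw [← hn, ← Fintype.card_coe s]
    exact Finset.card_image_le.trans_lt (Finset.card_compl_lt_iff_nonempty I |>.2 hIne)
  rw [hface]
  exact ih _ hcard _ rfl

end AffineDependence

section PolynomialMaps

variable {M G H : Type*} [AddCommMonoid M] [AddCommGroup G] [AddCommGroup H]

/-- The polynomial maps of degree less than `n` in the sense of Fréchet: all their mixed differences
of order `n` vanish. -/
def polynomialLT (M G : Type*) [AddCommMonoid M] [AddCommGroup G] : ℕ → AddSubgroup (M → G)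
  | 0 => ⊥
  | n + 1 => ⨅ h : M, (polynomialLT M G n).comap (fwdDiff_aux.fwdDiffₗ M G h).toAddMonoidHom

theorem mem_polynomialLT_zero {f : M → G} : f ∈ polynomialLT M G 0 ↔ f = 0 :=
  AddSubgroup.mem_bot

theorem mem_polynomialLT_succ {n : ℕ} {f : M → G} :
    f ∈ polynomialLT M G (n + 1) ↔ ∀ h, Δ_[h] f ∈ polynomialLT M G n :=
  AddSubgroup.mem_iInf

theorem mem_polynomialLT_one {f : M → G} : f ∈ polynomialLT M G 1 ↔ ∀ x, f x = f 0 := by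
  simp only [mem_polynomialLT_succ, mem_polynomialLT_zero, funext_iff, fwdDiff, Pi.zero_apply,
    sub_eq_zero]
  exact ⟨fun h x => by simpa using h x 0, fun h x y => (h (y + x)).trans (h y).symm⟩

theorem polynomialLT_mono : Monotone (polynomialLT M G) := by
  refine monotone_nat_of_le_succ fun n => ?_
  induction n with
  | zero => exact bot_le
  | succ n ih =>
    intro f hf
    exact mem_polynomialLT_succ.2 fun h => ih (mem_polynomialLT_succ.1 hf h)

theorem comp_mem_polynomialLT (γ : G →+ H) {n : ℕ} {f : M → G} (hf : f ∈ polynomialLT M G n) :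
    γ ∘ f ∈ polynomialLT M H n := by
  induction n generalizing f with
  | zero => rw [mem_polynomialLT_zero] at hf ⊢; rw [hf]; exact funext fun _ => map_zero γ
  | succ n ih =>
    refine mem_polynomialLT_succ.2 fun h => ?_
    have hcomm : Δ_[h] (γ ∘ f) = γ ∘ Δ_[h] f := funext fun x => (map_sub γ _ _).symm
    exact hcomm ▸ ih (mem_polynomialLT_succ.1 hf h)

theorem isClosed_polynomialLT [TopologicalSpace G] [IsTopologicalAddGroup G] [T1Space G] (n : ℕ) :
    IsClosed (polynomialLT M G n : Set (M → G)) := by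
  induction n with
  | zero => exact isClosed_singleton
  | succ n ih =>
    have hdiff (h : M) : Continuous fun f : M → G => Δ_[h] f := by
      unfold fwdDiff
      fun_prop
    have hInter : (polynomialLT M G (n + 1) : Set (M → G)) =
        ⋂ h, (fun f => Δ_[h] f) ⁻¹' polynomialLT M G n :=
      ext fun f => by simp only [SetLike.mem_coe, mem_polynomialLT_succ, mem_iInter, mem_preimage]
    exact hInter ▸ isClosed_iInter fun h => ih.preimage (hdiff h)

end PolynomialMaps

section SimplexSlice

variable {ι A : Type*} [Fintype ι] [DecidableEq ι] [AddCommGroup A]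

/-- The points of the positive orthant whose coordinates outside `I` are bounded by `b` and whose
coordinate sum exceeds the sum of these bounds by `t`. For `I = univ` this is the standard simplex
dilated by `t`. -/
def simplexSlice (I : Finset ι) (b : ι → ℝ≥0) (t : ℝ≥0) : Set (ι → ℝ) :=
  {a | (∀ i, 0 ≤ a i) ∧ (∀ i ∉ I, a i ≤ b i) ∧ ∑ i, a i = t + ∑ i ∈ Iᶜ, (b i : ℝ)}

variable {I : Finset ι} {b : ι → ℝ≥0} {j : ι}

theorem convex_simplexSlice (t : ℝ≥0) : Convex ℝ (simplexSlice I b t) := by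
  rintro x ⟨hx0, hxb, hx⟩ y ⟨hy0, hyb, hy⟩ r s hr hs hrs
  refine ⟨fun i => add_nonneg (mul_nonneg hr (hx0 i)) (mul_nonneg hs (hy0 i)),
    fun i hi => convex_Iic (𝕜 := ℝ) (b i : ℝ) (hxb i hi) (hyb i hi) hr hs hrs, ?_⟩
  simp only [Pi.add_apply, Pi.smul_apply, smul_eq_mul, Finset.sum_add_distrib, ← Finset.mul_sum, hx,
    hy, ← add_mul, hrs, one_mul]

theorem isCompact_simplexSlice (t : ℝ≥0) : IsCompact (simplexSlice I b t) := by
  have hclosed : IsClosed (simplexSlice I b t) := by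
    simp only [simplexSlice, ofPred_and, ofPred_forall]
    exact (isClosed_iInter fun i => isClosed_le continuous_const (continuous_apply i)).inter
      ((isClosed_biInter fun i _ => isClosed_le (continuous_apply i) continuous_const).inter
        (isClosed_eq (by fun_prop) continuous_const))
  refine (isCompact_Icc (a := 0) (b := fun _ => t + ∑ i ∈ Iᶜ, (b i : ℝ))).of_isClosed_subset hclosed
    fun a ⟨ha0, _, ha⟩ => ⟨ha0, fun i => ?_⟩
  exact (Finset.single_le_sum (fun i _ => ha0 i) (Finset.mem_univ i)).trans ha.le

theorem simplexSlice_inter_le (hj : j ∈ I) (h t : ℝ≥0) :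
    simplexSlice I b (t + h) ∩ {a | a j ≤ h} =
      simplexSlice (I.erase j) (Function.update b j h) t := by
  have hbound (a : ι → ℝ) : (∀ i ∉ I.erase j, a i ≤ Function.update b j h i) ↔
      (∀ i ∉ I, a i ≤ b i) ∧ a j ≤ h := by
    grind [Function.update_apply]
  have hsum : ∑ i ∈ (I.erase j)ᶜ, (Function.update b j h i : ℝ) = h + ∑ i ∈ Iᶜ, (b i : ℝ) := by
    rw [Finset.compl_erase, Finset.sum_insert (by simpa using hj), Function.update_self]
    congr 1
    refine Finset.sum_congr rfl fun i hi => ?_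
    rw [Function.update_of_ne (by rintro rfl; exact Finset.mem_compl.1 hi hj)]
  ext a
  simp only [simplexSlice, mem_inter_iff, mem_ofPred_eq, hbound, hsum, NNReal.coe_add, add_assoc]
  tauto

theorem simplexSlice_inter_ge (hj : j ∈ I) (h t : ℝ≥0) :
    simplexSlice I b (t + h) ∩ {a | h ≤ a j} =
      (Pi.single j (h : ℝ) : ι → ℝ) +ᵥ simplexSlice I b t := by
  ext a
  have hne {i : ι} (hi : i ≠ j) : (-(Pi.single j (h : ℝ)) + a : ι → ℝ) i = a i := by simp [hi]
  have hself : (-(Pi.single j (h : ℝ)) + a : ι → ℝ) j = a j - h := by simp; ring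
  have hsum : ∑ i, (-(Pi.single j (h : ℝ)) + a : ι → ℝ) i = ∑ i, a i - h := by
    simp [Finset.sum_add_distrib]; ring
  have hbound : (∀ i ∉ I, (-(Pi.single j (h : ℝ)) + a : ι → ℝ) i ≤ b i) ↔ ∀ i ∉ I, a i ≤ b i :=
    forall₂_congr fun i hi => by rw [hne (ne_of_mem_of_not_mem hj hi).symm]
  have hpos : (∀ i, 0 ≤ (-(Pi.single j (h : ℝ)) + a : ι → ℝ) i) ↔ (∀ i, 0 ≤ a i) ∧ h ≤ a j := by
    constructor
    · intro ha
      have haj : h ≤ a j := sub_nonneg.1 (hself ▸ ha j)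
      refine ⟨fun i => ?_, haj⟩
      rcases eq_or_ne i j with rfl | hi
      · exact h.coe_nonneg.trans haj
      · exact hne hi ▸ ha i
    · rintro ⟨ha, haj⟩ i
      rcases eq_or_ne i j with rfl | hi
      · exact hself ▸ sub_nonneg.2 haj
      · exact (hne hi).symm ▸ ha i
  rw [mem_vadd_set_iff_neg_vadd_mem, vadd_eq_add]
  simp only [simplexSlice, mem_inter_iff, mem_ofPred_eq, hbound, hsum, hpos, NNReal.coe_add,
    sub_eq_iff_eq_add, add_right_comm]
  tauto

theorem simplexSlice_inter_eq (hj : j ∈ I) (h t : ℝ≥0) :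
    simplexSlice I b (t + h) ∩ {a | a j = h} =
      (Pi.single j (h : ℝ) : ι → ℝ) +ᵥ simplexSlice (I.erase j) (Function.update b j 0) t := by
  have hsplit : {a : ι → ℝ | a j = h} = {a | (h : ℝ) ≤ a j} ∩ {a | a j ≤ (h : ℝ)} :=
    ext fun a => (le_antisymm_iff (a := a j)).trans and_comm
  have hle : {a : ι → ℝ | a j ≤ h} = (Pi.single j (h : ℝ) : ι → ℝ) +ᵥ {a : ι → ℝ | a j ≤ 0} := by
    ext a
    simp [mem_vadd_set_iff_neg_vadd_mem]
  rw [hsplit, ← inter_assoc, simplexSlice_inter_ge hj, hle, ← vadd_set_inter,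
    ← simplexSlice_inter_le hj, add_zero, NNReal.coe_zero]

theorem simplexSlice_singleton (t : ℝ≥0) :
    simplexSlice {j} b t = (Pi.single j (t : ℝ) : ι → ℝ) +ᵥ simplexSlice {j} b 0 := by
  rw [← simplexSlice_inter_ge (Finset.mem_singleton_self j), zero_add, eq_comm, inter_eq_left]
  rintro a ⟨-, hb, hsum⟩
  rw [Fintype.sum_eq_add_sum_compl j] at hsum
  have hle : ∑ i ∈ {j}ᶜ, a i ≤ ∑ i ∈ {j}ᶜ, (b i : ℝ) :=
    Finset.sum_le_sum fun i hi => hb i (Finset.mem_compl.1 hi)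
  exact (by linarith : (t : ℝ) ≤ a j)

theorem simplexSlice_univ [Nonempty ι] (t : ℝ≥0) :
    simplexSlice Finset.univ b t = (t : ℝ) • stdSimplex ℝ ι := by
  ext a
  simp only [simplexSlice, Finset.compl_univ, Finset.sum_empty, add_zero, mem_ofPred_eq,
    Finset.mem_univ, not_true_eq_false, IsEmpty.forall_iff, implies_true, true_and]
  constructor
  · rintro ⟨ha0, ha⟩
    rcases eq_or_ne t 0 with rfl | ht
    · have ha' : a = 0 := funext fun i =>
        (Finset.sum_eq_zero_iff_of_nonneg fun i _ => ha0 i).1 ha i (Finset.mem_univ i)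
      rw [NNReal.coe_zero, zero_smul_set ⟨_, single_mem_stdSimplex ℝ (Classical.arbitrary ι)⟩]
      exact ha'
    · have ht' : (t : ℝ) ≠ 0 := NNReal.coe_ne_zero.2 ht
      refine (mem_smul_set_iff_inv_smul_mem₀ ht' _ _).2
        ⟨fun i => mul_nonneg (inv_nonneg.2 t.coe_nonneg) (ha0 i), ?_⟩
      simp only [Pi.smul_apply, smul_eq_mul, ← Finset.mul_sum, ha, inv_mul_cancel₀ ht']
  · rintro ⟨c, ⟨hc0, hc⟩, rfl⟩
    refine ⟨fun i => mul_nonneg t.coe_nonneg (hc0 i), ?_⟩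
    simp only [Pi.smul_apply, smul_eq_mul, ← Finset.mul_sum, hc, mul_one]

theorem IsSetValuation.simplexSlice_mem_polynomialLT {θ : Set (ι → ℝ) → A} (hθ : IsSetValuation θ)
    (hinv : ∀ (v : ι → ℝ) K, θ (v +ᵥ K) = θ K) {n : ℕ} (hI : I.card = n + 1) (b : ι → ℝ≥0) :
    (fun t => θ (simplexSlice I b t)) ∈ polynomialLT ℝ≥0 A (n + 1) := by
  induction n generalizing I b with
  | zero =>
    obtain ⟨j, rfl⟩ := Finset.card_eq_one.1 hI
    refine mem_polynomialLT_one.2 fun t => ?_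
    rw [simplexSlice_singleton, hinv]
  | succ n ih =>
    have hpos : 0 < I.card := by lia
    obtain ⟨j, hj⟩ := Finset.card_pos.1 hpos
    have hcard : (I.erase j).card = n + 1 := by rw [Finset.card_erase_of_mem hj, hI]; rfl
    refine mem_polynomialLT_succ.2 fun h => ?_
    have hdiff : Δ_[h] (fun t => θ (simplexSlice I b t)) =
        (fun t => θ (simplexSlice (I.erase j) (Function.update b j h) t)) -
          fun t => θ (simplexSlice (I.erase j) (Function.update b j 0) t) := by
      funext t
      have hcut := hθ.cut (.proj j) h (convex_simplexSlice (I := I) (b := b) (t + h))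
        (isCompact_simplexSlice _)
      simp only [ContinuousLinearMap.proj_apply] at hcut
      rw [simplexSlice_inter_le hj, simplexSlice_inter_ge hj, simplexSlice_inter_eq hj, hinv,
        hinv] at hcut
      simp only [fwdDiff, Pi.sub_apply, hcut]
      abel
    rw [hdiff]
    exact sub_mem (ih hcard _) (ih hcard _)

end SimplexSlice

section ConvexBodyValuation

variable {V A B : Type*} [AddCommGroup V] [Module ℝ V] [TopologicalSpace V] [AddCommGroup A]
  [AddCommGroup B]

open Classical in
/-- The extension by zero of a function on convex bodies to all sets. -/
noncomputable def extendByZero (φ : ConvexBody V → A) (S : Set V) : A :=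
  if h : Convex ℝ S ∧ IsCompact S ∧ S.Nonempty then φ ⟨S, h.1, h.2.1, h.2.2⟩ else 0

theorem extendByZero_coe (φ : ConvexBody V → A) (K : ConvexBody V) : extendByZero φ K = φ K :=
  dif_pos ⟨K.convex, K.isCompact, K.nonempty⟩

theorem extendByZero_empty (φ : ConvexBody V → A) : extendByZero φ ∅ = 0 :=
  dif_neg fun h => Set.not_nonempty_empty h.2.2

theorem isSetValuation_extendByZero [IsTopologicalAddGroup V] [ContinuousSMul ℝ V] [T2Space V]
    {φ : ConvexBody V → A} (hφ : ConvexBody.IsValuation φ) : IsSetValuation (extendByZero φ) where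
  empty := extendByZero_empty φ
  union B C hB hC hBc hCc h := by
    rcases B.eq_empty_or_nonempty with rfl | hBne
    · simp only [empty_union, empty_inter, extendByZero_empty, zero_add, sub_zero]
    rcases C.eq_empty_or_nonempty with rfl | hCne
    · simp only [union_empty, inter_empty, extendByZero_empty, add_zero, sub_zero]
    have hne := inter_nonempty_of_convex_union hBne hCne hBc.isClosed hCc.isClosed h
    simpa only [← extendByZero_coe φ] using! hφ ⟨B, hB, hBc, hBne⟩ ⟨C, hC, hCc, hCne⟩
      ⟨B ∪ C, h, hBc.union hCc, hBne.inl⟩ ⟨B ∩ C, hB.inter hC, hBc.inter hCc, hne⟩ rfl rfl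

theorem extendByZero_vadd [IsTopologicalAddGroup V] {φ : ConvexBody V → A}
    (hφ : ConvexBody.IsTranslationInvariant φ) (x : V) (S : Set V) :
    extendByZero φ (x +ᵥ S) = extendByZero φ S := by
  by_cases h : Convex ℝ S ∧ IsCompact S ∧ S.Nonempty
  · let K : ConvexBody V := ⟨S, h.1, h.2.1, h.2.2⟩
    have hK : (ConvexBody.translate x K : Set V) = x +ᵥ S := rfl
    rw [← hK, extendByZero_coe, hφ, ← extendByZero_coe φ K]
    rfl
  · have h' : ¬ (Convex ℝ (x +ᵥ S) ∧ IsCompact (x +ᵥ S) ∧ (x +ᵥ S).Nonempty) := by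
      have hcompact : IsCompact (x +ᵥ S) ↔ IsCompact S := (Homeomorph.addLeft x).isCompact_image
      rwa [convex_vadd, hcompact, vadd_set_nonempty]
    rw [extendByZero, dif_neg h', extendByZero, dif_neg h]

theorem isValuation_comp {φ : ConvexBody V → A} (hφ : ConvexBody.IsValuation φ) (γ : A →+ B) :
    ConvexBody.IsValuation fun X => γ (φ X) := fun B C U I hU hI => by
  simp only [hφ B C U I hU hI, map_sub, map_add]

section Hull

variable [IsTopologicalAddGroup V] [ContinuousSMul ℝ V]

/-- The convex hull of a nonempty finite set of points. -/
def hull (s : Finset V) (hs : s.Nonempty) : ConvexBody V where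
  carrier := convexHull ℝ s
  convex' := convex_convexHull ℝ _
  isCompact' := s.finite_toSet.isCompact_convexHull ℝ
  nonempty' := hs.to_set.convexHull

theorem smul_hull_mem_polynomialLT [T2Space V] {φ : ConvexBody V → A}
    (hφ : ConvexBody.IsValuation φ) (hinv : ConvexBody.IsTranslationInvariant φ) (s : Finset V)
    (hs : s.Nonempty) : (fun t : ℝ≥0 => φ (t • hull s hs)) ∈ polynomialLT ℝ≥0 A s.card := by
  classical
  have : Nonempty s := hs.to_subtype
  let L := LinearMap.toContinuousLinearMap (Fintype.linearCombination ℝ ((↑) : s → V))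
  have hL : L '' stdSimplex ℝ s = convexHull ℝ s := linearCombination_coe_image_stdSimplex s
  have hLinv (v : s → ℝ) (K : Set (s → ℝ)) :
      extendByZero φ (L '' (v +ᵥ K)) = extendByZero φ (L '' K) := by
    rw [← extendByZero_vadd hinv (L v) (L '' K)]
    congr 1
    exact image_vadd_distrib L v K
  have hslice (t : ℝ≥0) :
      φ (t • hull s hs) = extendByZero φ (L '' simplexSlice Finset.univ 0 t) := by
    rw [← extendByZero_coe φ, ConvexBody.coe_smul', simplexSlice_univ, image_smul_set, hL]
    rfl
  obtain ⟨n, hn⟩ : ∃ n, s.card = n + 1 := Nat.exists_eq_add_one.2 hs.card_pos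
  simp only [hslice, hn]
  exact ((isSetValuation_extendByZero hφ).image L).simplexSlice_mem_polynomialLT hLinv
    (by rw [Finset.card_univ, Fintype.card_coe, hn]) 0

end Hull

end ConvexBodyValuation

section Approximation

variable {V A : Type*} [NormedAddCommGroup V] [NormedSpace ℝ V]

theorem exists_dist_hull_le (X : ConvexBody V) {ε : ℝ} (hε : 0 < ε) :
    ∃ s, ∃ hs : s.Nonempty, dist (hull s hs) X ≤ ε := by
  obtain ⟨t, htX, htf, hcover⟩ := X.isCompact.finite_cover_balls hε
  have hnear {x : V} (hx : x ∈ X) : ∃ y ∈ t, dist x y < ε := by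
    simpa only [mem_iUnion₂, Metric.mem_ball, exists_prop] using hcover hx
  obtain ⟨x₀, hx₀⟩ := X.nonempty
  obtain ⟨y₀, hy₀, -⟩ := hnear hx₀
  lift t to Finset V using htf
  have hsub : (hull t ⟨y₀, hy₀⟩ : Set V) ⊆ X := convexHull_min htX X.convex
  refine ⟨t, ⟨y₀, hy₀⟩, Metric.hausdorffDist_le_of_mem_dist hε.le
    (fun x hx => ⟨x, hsub hx, (dist_self x).trans_le hε.le⟩) fun x hx => ?_⟩
  obtain ⟨y, hy, hxy⟩ := hnear hx
  exact ⟨y, subset_convexHull ℝ _ hy, hxy.le⟩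

theorem eq_zero_of_hull_eq_zero [FiniteDimensional ℝ V] [AddCommGroup A] [TopologicalSpace A]
    [T1Space A] {φ : ConvexBody V → A} (hcont : Continuous φ) (hφ : ConvexBody.IsValuation φ)
    (h : ∀ s hs, s.card ≤ finrank ℝ V + 1 → φ (hull s hs) = 0) (X : ConvexBody V) : φ X = 0 := by
  have hhull (s : Finset V) (hs : s.Nonempty) : φ (hull s hs) = 0 := by
    rw [← extendByZero_coe φ]
    refine (isSetValuation_extendByZero hφ).convexHull_eq_zero (fun u hu => ?_) s
    rcases u.eq_empty_or_nonempty with rfl | hne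
    · rw [Finset.coe_empty, convexHull_empty, extendByZero_empty]
    · exact (extendByZero_coe φ (hull u hne)).trans (h u hne hu)
  have hclosed : IsClosed (φ ⁻¹' {0}) := isClosed_singleton.preimage hcont
  have hmem : X ∈ closure (φ ⁻¹' {0}) := by
    refine Metric.mem_closure_iff.2 fun ε hε => ?_
    obtain ⟨s, hs, hX⟩ := exists_dist_hull_le X (half_pos hε)
    exact ⟨hull s hs, hhull s hs, by rw [dist_comm]; linarith⟩
  exact hclosed.closure_subset hmem

end Approximation

section Dilation

variable {V A : Type*} [NormedAddCommGroup V] [NormedSpace ℝ V]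

theorem exists_mem_dist_le_dist (X Y : ConvexBody V) {x : V} (hx : x ∈ X) :
    ∃ y ∈ Y, dist x y ≤ dist X Y := by
  obtain ⟨y, hy, hxy⟩ := Y.isCompact.exists_infDist_eq_dist Y.nonempty x
  exact ⟨y, hy, hxy ▸ Metric.infDist_le_hausdorffDist_of_mem hx ConvexBody.hausdorffEDist_ne_top⟩

theorem dist_smul_smul_le (t : ℝ≥0) (X Y : ConvexBody V) : dist (t • X) (t • Y) ≤ t * dist X Y := by
  have hnear (X Y : ConvexBody V) :
      ∀ x ∈ t • X, ∃ y ∈ t • Y, dist x y ≤ t * dist X Y := by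
    rintro _ ⟨x, hx, rfl⟩
    obtain ⟨y, hy, hxy⟩ := exists_mem_dist_le_dist X Y hx
    refine ⟨t • y, smul_mem_smul_set hy, ?_⟩
    change dist ((t : ℝ) • x) ((t : ℝ) • y) ≤ _
    rw [dist_smul₀, Real.norm_of_nonneg t.coe_nonneg]
    gcongr
  refine Metric.hausdorffDist_le_of_mem_dist (by positivity) (hnear X Y) ?_
  rw [dist_comm X Y]
  exact hnear Y X

theorem dist_smul_le_of_norm_le {X : ConvexBody V} {C : ℝ} (hC : ∀ x ∈ X, ‖x‖ ≤ C) (s t : ℝ≥0) :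
    dist (s • X) (t • X) ≤ dist s t * C := by
  have hnear (s t : ℝ≥0) : ∀ x ∈ s • X, ∃ y ∈ t • X, dist x y ≤ dist s t * C := by
    rintro _ ⟨x, hx, rfl⟩
    refine ⟨t • x, smul_mem_smul_set hx, ?_⟩
    simp only [NNReal.smul_def]
    rw [dist_eq_norm, ← sub_smul, norm_smul, NNReal.dist_eq, Real.norm_eq_abs]
    gcongr
    exact hC x hx
  obtain ⟨x₀, hx₀⟩ := X.nonempty
  have hC0 : 0 ≤ C := (norm_nonneg _).trans (hC x₀ hx₀)
  refine Metric.hausdorffDist_le_of_mem_dist (by positivity) (hnear s t) ?_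
  rw [dist_comm s t]
  exact hnear t s

theorem continuous_dilation : Continuous fun z : ℝ≥0 × ConvexBody V => z.1 • z.2 := by
  refine continuous_iff_continuousAt.2 fun ⟨t, X⟩ => ?_
  obtain ⟨C, hC⟩ := X.isBounded.exists_norm_le
  rw [ContinuousAt, tendsto_iff_dist_tendsto_zero]
  have hbound : Continuous fun z : ℝ≥0 × ConvexBody V => z.1 * dist z.2 X + dist z.1 t * C := by
    fun_prop
  refine squeeze_zero (fun _ => dist_nonneg) (fun z => ?_)
    (by simpa using hbound.tendsto (t, X))
  exact (dist_triangle _ (z.1 • X) _).trans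
    (add_le_add (dist_smul_smul_le z.1 z.2 X) (dist_smul_le_of_norm_le hC z.1 t))

theorem isValuation_comp_smul [AddCommGroup A] {φ : ConvexBody V → A}
    (hφ : ConvexBody.IsValuation φ) (t : ℝ≥0) : ConvexBody.IsValuation fun X => φ (t • X) := by
  intro B C U I hU hI
  rcases eq_or_ne t 0 with rfl | ht
  · simp only [zero_smul, add_sub_cancel_right]
  · refine hφ _ _ _ _ ?_ ?_ <;> simp only [ConvexBody.coe_smul']
    · rw [hU, smul_set_union]
    · rw [hI, smul_set_inter₀ ht]

theorem isTranslationInvariant_comp_smul {φ : ConvexBody V → A}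
    (hφ : ConvexBody.IsTranslationInvariant φ) (t : ℝ≥0) :
    ConvexBody.IsTranslationInvariant fun X => φ (t • X) := by
  intro x K
  have hsmul : t • ConvexBody.translate x K = ConvexBody.translate (t • x) (t • K) := by
    refine ConvexBody.ext ?_
    change t • (x + ·) '' (K : Set V) = (t • x + ·) '' (t • (K : Set V))
    simp only [← image_smul, image_image, smul_add]
  simp only [hsmul, hφ _ _]

end Dilation

section ContinuousPolynomials

variable {A : Type*} [AddCommGroup A] [TopologicalSpace A] [IsTopologicalAddGroup A] {n : ℕ}

/-- The continuous polynomial maps of degree less than `n` on the half-line. -/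
def contPolynomialLT (A : Type*) [AddCommGroup A] [TopologicalSpace A] [IsTopologicalAddGroup A]
    (n : ℕ) : AddSubgroup C(ℝ≥0, A) :=
  (polynomialLT ℝ≥0 A n).comap ContinuousMap.coeFnAddMonoidHom

theorem isClosed_contPolynomialLT [T1Space A] :
    IsClosed (contPolynomialLT A n : Set C(ℝ≥0, A)) :=
  (isClosed_polynomialLT n).preimage continuous_coeFun

end ContinuousPolynomials

section Ray

variable {V A : Type*} [NormedAddCommGroup V] [NormedSpace ℝ V] [TopologicalSpace A]

/-- The function `t ↦ φ (t X)`, for a continuous function `φ` on convex bodies. -/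
noncomputable def ray (φ : C(ConvexBody V, A)) (X : ConvexBody V) : C(ℝ≥0, A) where
  toFun t := φ (t • X)
  continuous_toFun := φ.continuous.comp (continuous_dilation.comp (.prodMk_left X))

theorem continuous_ray (φ : C(ConvexBody V, A)) : Continuous (ray φ) :=
  ContinuousMap.continuous_of_continuous_uncurry _
    (φ.continuous.comp (continuous_dilation.comp continuous_swap))

theorem isTranslationInvariant_ray {φ : C(ConvexBody V, A)}
    (hφ : ConvexBody.IsTranslationInvariant φ) : ConvexBody.IsTranslationInvariant (ray φ) :=
  fun x K => ContinuousMap.ext fun t => isTranslationInvariant_comp_smul hφ t x K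

variable [AddCommGroup A] [IsTopologicalAddGroup A]

theorem isValuation_ray {φ : C(ConvexBody V, A)} (hφ : ConvexBody.IsValuation φ) :
    ConvexBody.IsValuation (ray φ) := fun B C U I hU hI =>
  ContinuousMap.ext fun t => isValuation_comp_smul hφ t B C U I hU hI

/-- McMullen's polynomiality theorem, for values in an arbitrary group. -/
theorem ray_mem_contPolynomialLT [FiniteDimensional ℝ V] [T1Space A] {φ : C(ConvexBody V, A)}
    (hφ : ConvexBody.IsValuation φ) (hinv : ConvexBody.IsTranslationInvariant φ)
    (X : ConvexBody V) : ray φ X ∈ contPolynomialLT A (finrank ℝ V + 1) := by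
  let P := contPolynomialLT A (finrank ℝ V + 1)
  have hT1 : T1Space (C(ℝ≥0, A) ⧸ P) := QuotientAddGroup.t1Space_iff.2 isClosed_contPolynomialLT
  have hcont : Continuous fun X => QuotientAddGroup.mk' P (ray φ X) :=
    continuous_quot_mk.comp (continuous_ray φ)
  have hhull (s : Finset V) (hs : s.Nonempty) (hcard : s.card ≤ finrank ℝ V + 1) :
      QuotientAddGroup.mk' P (ray φ (hull s hs)) = 0 :=
    (QuotientAddGroup.eq_zero_iff _).2
      (polynomialLT_mono hcard (smul_hull_mem_polynomialLT hφ hinv s hs))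
  exact (QuotientAddGroup.eq_zero_iff _).1 (eq_zero_of_hull_eq_zero hcont
    (isValuation_comp (isValuation_ray hφ) (QuotientAddGroup.mk' P)) hhull X)

end Ray

section OneParameter

variable {A : Type*} [AddCommGroup A] [TopologicalSpace A] [IsTopologicalAddGroup A]

/-- The one-parameter group `t ↦ γ (t s)`. -/
def rescale (s : ℝ) (γ : ℝ →ₜ+ A) : ℝ →ₜ+ A where
  toFun t := γ (t * s)
  map_zero' := by rw [zero_mul, map_zero]
  map_add' a b := by rw [add_mul, map_add]
  continuous_toFun := γ.continuous_toFun.comp (continuous_mul_const s)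

/-- The one-parameter groups of an abelian topological group form a real vector space. -/
instance oneParameterModule : Module ℝ (ℝ →ₜ+ A) where
  smul := rescale
  one_smul γ := ContinuousAddMonoidHom.ext fun t => congrArg γ (mul_one t)
  mul_smul r s γ := ContinuousAddMonoidHom.ext fun t => congrArg γ (by ring)
  smul_zero _ := rfl
  smul_add _ _ _ := rfl
  add_smul r s γ := ContinuousAddMonoidHom.ext fun t =>
    (congrArg γ (mul_add t r s)).trans (map_add γ _ _)
  zero_smul γ := ContinuousAddMonoidHom.ext fun t => (congrArg γ (mul_zero t)).trans (map_zero γ)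

theorem oneParameter_smul_apply (s : ℝ) (γ : ℝ →ₜ+ A) (t : ℝ) : (s • γ) t = γ (t * s) :=
  rfl

instance continuousSMul_oneParameter : ContinuousSMul ℝ (ℝ →ₜ+ A) where
  continuous_smul := by
    refine ContinuousAddMonoidHom.continuous_of_continuous_uncurry _ ?_
    have huncurry : Continuous fun z : (ℝ × (ℝ →ₜ+ A)) × ℝ => z.1.2 (z.2 * z.1.1) := by fun_prop
    exact huncurry

/-- The extension of a continuous homomorphism from the half-line to the line. -/
noncomputable def realExtension (γ : ℝ≥0 →ₜ+ A) : ℝ →ₜ+ A where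
  toFun t := γ t.toNNReal - γ (-t).toNNReal
  map_zero' := by simp only [neg_zero, sub_self]
  map_add' s t := by
    have hparts : s.toNNReal + t.toNNReal + (-(s + t)).toNNReal =
        (s + t).toNNReal + ((-s).toNNReal + (-t).toNNReal) := by
      refine NNReal.eq ?_
      simp only [NNReal.coe_add, Real.coe_toNNReal']
      linarith [max_zero_sub_eq_self s, max_zero_sub_eq_self t, max_zero_sub_eq_self (s + t)]
    have hγ := congrArg γ hparts
    simp only [map_add] at hγ
    rw [sub_add_sub_comm, sub_eq_sub_iff_add_eq_add, hγ]
  continuous_toFun := by fun_prop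

theorem realExtension_coe (γ : ℝ≥0 →ₜ+ A) (t : ℝ≥0) : realExtension γ t = γ t := by
  change γ (t : ℝ).toNNReal - γ (-(t : ℝ)).toNNReal = γ t
  rw [Real.toNNReal_coe, Real.toNNReal_of_nonpos (neg_nonpos.2 t.coe_nonneg), map_zero, sub_zero]

theorem map_eq_smul_map_one [Module ℝ A] [ContinuousSMul ℝ A] [T2Space A] (γ : ℝ≥0 →ₜ+ A)
    (t : ℝ≥0) : γ t = t • γ 1 := by
  have hlin := map_real_smul (realExtension γ) (realExtension γ).continuous_toFun t 1
  rwa [smul_eq_mul, mul_one, realExtension_coe, ← NNReal.coe_one, realExtension_coe] at hlin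

end OneParameter

section DividedPower

open Polynomial

theorem eval_mem_polynomialLT {n : ℕ} {p : ℝ[X]} (hp : p.degree < n) :
    (fun t : ℝ≥0 => p.eval (t : ℝ)) ∈ polynomialLT ℝ≥0 ℝ n := by
  induction n generalizing p with
  | zero =>
    obtain rfl : p = 0 := degree_eq_bot.1 (WithBot.lt_coe_bot.1 hp)
    exact mem_polynomialLT_zero.2 (funext fun t => eval_zero)
  | succ n ih =>
    refine mem_polynomialLT_succ.2 fun h => ?_
    have hdiff : Δ_[h] (fun t : ℝ≥0 => p.eval (t : ℝ)) =
        fun t : ℝ≥0 => (taylor (h : ℝ) p - p).eval (t : ℝ) := by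
      funext t
      rw [fwdDiff, eval_sub, taylor_eval, NNReal.coe_add]
    rw [hdiff]
    rcases eq_or_ne p 0 with rfl | hp0
    · exact ih (by simp)
    · refine ih ((degree_sub_lt_left (degree_taylor p _) ?_ (leadingCoeff_taylor _ p)).trans_le ?_)
      · rwa [Ne, taylor_eq_zero]
      · rw [degree_taylor]
        exact Order.le_of_lt_succ hp

/-- The divided power `t ↦ t ^ n / n!`. -/
noncomputable def dividedPow (n : ℕ) : C(ℝ≥0, ℝ) where
  toFun t := t ^ n / n.factorial
  continuous_toFun := by fun_prop

theorem fwdDiff_dividedPow_sub_mem_polynomialLT (n : ℕ) (h : ℝ≥0) :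
    Δ_[h] (dividedPow (n + 2)) - h • ⇑(dividedPow (n + 1)) ∈ polynomialLT ℝ≥0 ℝ (n + 1) := by
  let q (m : ℕ) : ℝ[X] := C (m.factorial : ℝ)⁻¹ * X ^ m
  have hq : Δ_[h] (dividedPow (n + 2)) - h • ⇑(dividedPow (n + 1)) = fun t : ℝ≥0 =>
      (taylor (h : ℝ) (q (n + 2)) - q (n + 2) - C (h : ℝ) * q (n + 1)).eval (t : ℝ) := by
    funext t
    simp [q, dividedPow, fwdDiff, NNReal.smul_def, div_eq_inv_mul]
  rw [hq]
  refine eval_mem_polynomialLT ((degree_lt_iff_coeff_zero _ _).2 fun m hm => ?_)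
  simp only [q, taylor_mul, taylor_C, taylor_X_pow, coeff_sub, coeff_C_mul, coeff_X_add_C_pow,
    coeff_X_pow]
  obtain rfl | rfl | hlt : m = n + 1 ∨ m = n + 2 ∨ n + 2 < m := by lia
  · have hfact : ((n + 1).factorial : ℝ) ≠ 0 := by positivity
    rw [Nat.choose_succ_self_right, Nat.factorial_succ (n + 1), Nat.add_sub_add_left,
      if_neg (by lia), if_pos rfl]
    push_cast
    field_simp
    ring
  · simp
  · simp [Nat.choose_eq_zero_of_lt hlt, hlt.ne', (hlt.trans' (n + 1).lt_succ_self).ne']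

end DividedPower

section LeadingTerm

variable {A : Type*} [AddCommGroup A] [TopologicalSpace A] [IsTopologicalAddGroup A] {n : ℕ}

theorem fwdDiff_add_sub_sub {M G : Type*} [AddCommMonoid M] [AddCommGroup G] (f : M → G)
    (h k : M) : Δ_[h + k] f - Δ_[h] f - Δ_[k] f = Δ_[h] (Δ_[k] f) := by
  funext t
  simp only [fwdDiff, Pi.sub_apply, add_assoc]
  abel

/-- The difference operator `F ↦ Δ_[h] F`, which lowers the degree of a polynomial map. -/
def diffHom (n : ℕ) (h : ℝ≥0) : contPolynomialLT A (n + 1) →ₜ+ contPolynomialLT A n where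
  toFun F := ⟨F.1.comp ⟨fun t => t + h, by fun_prop⟩ - F.1, mem_polynomialLT_succ.1 F.2 h⟩
  map_zero' := Subtype.ext (sub_self _)
  map_add' F G := Subtype.ext (ContinuousMap.ext fun t => add_sub_add_comm (F.1 (t + h)) _ _ _)
  continuous_toFun := by fun_prop

theorem continuous_diffHom_apply (F : contPolynomialLT A (n + 1)) :
    Continuous fun h => diffHom n h F := by
  refine .subtype_mk (.sub (ContinuousMap.continuous_of_continuous_uncurry _ ?_) continuous_const) _
  simp only [Function.uncurry_def, ContinuousMap.comp_apply, ContinuousMap.coe_mk]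
  fun_prop

/-- The homomorphism `t ↦ F t - F 0` for an affine map `F`. -/
def subConst (F : contPolynomialLT A 2) : ℝ≥0 →ₜ+ A where
  toFun t := F.1 t - F.1 0
  map_zero' := sub_self _
  map_add' s t := by
    have hdiff : F.1 (s + t) - F.1 s = F.1 (0 + t) - F.1 0 :=
      mem_polynomialLT_one.1 (mem_polynomialLT_succ.1 F.2 t) s
    rw [← sub_add_sub_cancel, hdiff, zero_add, add_comm]
  continuous_toFun := by fun_prop

/-- The one-parameter group extending `subConst F`. -/
noncomputable def linearPart : contPolynomialLT A 2 →ₜ+ (ℝ →ₜ+ A) where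
  toAddMonoidHom := .mk' (fun F => realExtension (subConst F)) fun F G =>
    ContinuousAddMonoidHom.ext fun t => by
      change F.1 _ + G.1 _ - (F.1 0 + G.1 0) - (F.1 _ + G.1 _ - (F.1 0 + G.1 0)) =
        F.1 _ - F.1 0 - (F.1 _ - F.1 0) + (G.1 _ - G.1 0 - (G.1 _ - G.1 0))
      abel
  continuous_toFun := by
    refine ContinuousAddMonoidHom.continuous_of_continuous_uncurry _ ?_
    have huncurry : Continuous fun z : contPolynomialLT A 2 × ℝ =>
        (z.1.1 z.2.toNNReal - z.1.1 0) - (z.1.1 (-z.2).toNNReal - z.1.1 0) := by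
      fun_prop
    exact huncurry

theorem linearPart_coe (F : contPolynomialLT A 2) (t : ℝ≥0) :
    linearPart F t = F.1 t - F.1 0 :=
  realExtension_coe _ t

/-- The one-parameter group `γ` for which `γ (t ^ (n + 1) / (n + 1)!)` is the leading term of a
polynomial map of degree at most `n + 1`; see `sub_leadingTerm_mem_polynomialLT`. -/
noncomputable def leadingGroup : (n : ℕ) → contPolynomialLT A (n + 2) →ₜ+ (ℝ →ₜ+ A)
  | 0 => linearPart
  | n + 1 => (leadingGroup n).comp (diffHom (n + 2) 1)

theorem leadingGroup_eq_zero {F : contPolynomialLT A (n + 2)}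
    (hF : F.1 ∈ contPolynomialLT A (n + 1)) : leadingGroup n F = 0 := by
  induction n with
  | zero =>
    have hconst : ∀ t, F.1 t = F.1 0 := mem_polynomialLT_one.1 hF
    refine ContinuousAddMonoidHom.ext fun t => ?_
    change F.1 _ - F.1 0 - (F.1 _ - F.1 0) = 0
    rw [sub_sub_sub_cancel_right, hconst, hconst (-t).toNNReal, sub_self]
  | succ n ih => exact ih (mem_polynomialLT_succ.1 hF 1)

theorem leadingGroup_diffHom [T2Space A] (F : contPolynomialLT A (n + 3)) (h : ℝ≥0) :
    leadingGroup n (diffHom (n + 2) h F) = h • leadingGroup (n + 1) F := by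
  let γ : ℝ≥0 →+ (ℝ →ₜ+ A) :=
    { toFun := fun h => leadingGroup n (diffHom (n + 2) h F)
      map_zero' := leadingGroup_eq_zero (by
        have hzero : diffHom (n + 2) 0 F = 0 :=
          Subtype.ext (ContinuousMap.ext fun t => sub_eq_zero.2 (by simp))
        exact hzero ▸ zero_mem _)
      map_add' := fun h k => by
        have hmixed : leadingGroup n (diffHom (n + 2) (h + k) F - diffHom (n + 2) h F -
            diffHom (n + 2) k F) = 0 := by
          have hmem := mem_polynomialLT_succ.1 (mem_polynomialLT_succ.1 F.2 k) h
          rw [← fwdDiff_add_sub_sub] at hmem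
          exact leadingGroup_eq_zero hmem
        rwa [map_sub, map_sub, sub_sub, sub_eq_zero] at hmixed }
  exact map_eq_smul_map_one
    ⟨γ, (leadingGroup n).continuous_toFun.comp (continuous_diffHom_apply F)⟩ h

theorem sub_leadingTerm_mem_polynomialLT [T2Space A] (F : contPolynomialLT A (n + 2)) :
    ⇑F.1 - leadingGroup n F ∘ dividedPow (n + 1) ∈ polynomialLT ℝ≥0 A (n + 1) := by
  induction n with
  | zero =>
    refine mem_polynomialLT_one.2 fun t => ?_
    simp [dividedPow, leadingGroup, linearPart_coe]
  | succ n ih =>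
    refine mem_polynomialLT_succ.2 fun h => ?_
    set γ := leadingGroup (n + 1) F
    have hsplit : Δ_[h] (⇑F.1 - γ ∘ dividedPow (n + 2)) =
        (Δ_[h] ⇑F.1 - (h • γ) ∘ dividedPow (n + 1)) -
          γ ∘ (Δ_[h] (dividedPow (n + 2)) - h • ⇑(dividedPow (n + 1))) := by
      funext t
      simp only [fwdDiff, Pi.sub_apply, Function.comp_apply, Pi.smul_apply, NNReal.smul_def,
        oneParameter_smul_apply, map_sub, smul_eq_mul, mul_comm (h : ℝ)]
      abel
    rw [hsplit, ← leadingGroup_diffHom]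
    exact sub_mem (ih (diffHom (n + 2) h F)) (comp_mem_polynomialLT γ.toAddMonoidHom
      (fwdDiff_dividedPow_sub_mem_polynomialLT n h))

/-- Removing the leading term lowers the degree of a polynomial map. -/
noncomputable def subLeadingTerm [T2Space A] (n : ℕ) :
    contPolynomialLT A (n + 2) →ₜ+ contPolynomialLT A (n + 1) where
  toAddMonoidHom := .mk' (fun F =>
      ⟨F.1 - (leadingGroup n F : C(ℝ, A)).comp (dividedPow (n + 1)),
        sub_leadingTerm_mem_polynomialLT F⟩) fun F G => by
    refine Subtype.ext (ContinuousMap.ext fun t => ?_)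
    simp [add_sub_add_comm]
  continuous_toFun := by
    refine .subtype_mk (continuous_subtype_val.sub
      (ContinuousMap.continuous_of_continuous_uncurry _ ?_)) _
    have huncurry : Continuous fun z : contPolynomialLT A (n + 2) × ℝ≥0 =>
        leadingGroup n z.1 (dividedPow (n + 1) z.2) := by
      fun_prop
    exact huncurry

theorem exists_oneParameter_apply_one [T2Space A] (n : ℕ) :
    ∃ Φ : contPolynomialLT A (n + 1) →ₜ+ (ℝ →ₜ+ A), ∀ F, Φ F 1 = F.1 1 - F.1 0 := by
  induction n with
  | zero => exact ⟨0, fun F => (sub_eq_zero.2 (mem_polynomialLT_one.1 F.2 1)).symm⟩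
  | succ n ih =>
    obtain ⟨Φ, hΦ⟩ := ih
    let c : ℝ := ((n + 1).factorial : ℝ)⁻¹
    let σ : (ℝ →ₜ+ A) →ₜ+ (ℝ →ₜ+ A) :=
      ⟨DistribSMul.toAddMonoidHom _ c, continuous_const_smul c⟩
    refine ⟨Φ.comp (subLeadingTerm n) + σ.comp (leadingGroup n), fun F => ?_⟩
    have hΦF : Φ (subLeadingTerm n F) 1 = F.1 1 - leadingGroup n F (dividedPow (n + 1) 1) -
      (F.1 0 - leadingGroup n F (dividedPow (n + 1) 0)) := hΦ _
    have hσ : σ (leadingGroup n F) 1 = leadingGroup n F (1 * c) := rfl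
    have h0 : dividedPow (n + 1) 0 = 0 := by simp [dividedPow]
    have h1 : dividedPow (n + 1) 1 = 1 * c := by simp [dividedPow, c]
    change Φ (subLeadingTerm n F) 1 + σ (leadingGroup n F) 1 = _
    rw [hΦF, hσ, h0, h1, map_zero (leadingGroup n F), sub_zero]
    abel

end LeadingTerm

section Transfer

variable {V A B : Type*} [AddCommGroup V] [Module ℝ V] [TopologicalSpace V]

theorem isValuation_of_comp [AddCommGroup A] [AddCommGroup B] {f : ConvexBody V → A} {γ : A →+ B}
    (hγ : Function.Injective γ) (hf : ConvexBody.IsValuation fun X => γ (f X)) :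
    ConvexBody.IsValuation f := fun B C U I hU hI =>
  hγ (by simpa only [map_sub, map_add] using hf B C U I hU hI)

theorem isTranslationInvariant_comp_iff [ContinuousAdd V] {f : ConvexBody V → A} {γ : A → B}
    (hγ : Function.Injective γ) : (ConvexBody.IsTranslationInvariant fun X => γ (f X)) ↔
      ConvexBody.IsTranslationInvariant f :=
  forall₂_congr fun _ _ => hγ.eq_iff

theorem apply_point_eq_apply_zero [ContinuousAdd V] {φ : ConvexBody V → A}
    (hφ : ConvexBody.IsTranslationInvariant φ) (x : V) :
    φ (ConvexBody.point x) = φ (ConvexBody.point 0) := by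
  have hpoint : ConvexBody.point x = ConvexBody.translate x (ConvexBody.point 0) := by
    refine ConvexBody.ext ?_
    change ({x} : Set V) = (x + ·) '' {0}
    rw [image_singleton, add_zero]
  rw [hpoint, hφ]

end Transfer

/-- `W` is the span of the range of `f`, built as a quotient of the free vector space on `X` in
order to lie in the universe of `X`. -/
theorem exists_small_topologicalVectorSpace {X : Type u} {E : Type v} [AddCommGroup E] [Module ℝ E]
    [TopologicalSpace E] [IsTopologicalAddGroup E] [ContinuousSMul ℝ E] [T2Space E] (f : X → E) :
    ∃ (W : Type u) (_ : AddCommGroup W) (_ : Module ℝ W) (_ : TopologicalSpace W)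
      (_ : IsTopologicalAddGroup W) (_ : ContinuousSMul ℝ W) (_ : T2Space W)
      (T : W →ₗ[ℝ] E) (k : X → W), Topology.IsEmbedding T ∧ ∀ x, T (k x) = f x := by
  let p : (X →₀ ℝ) →ₗ[ℝ] E := Finsupp.linearCombination ℝ f
  let W := (X →₀ ℝ) ⧸ LinearMap.ker p
  let T : W →ₗ[ℝ] E := (LinearMap.ker p).liftQ p le_rfl
  have hT : Function.Injective T := LinearMap.ker_eq_bot.1 (Submodule.ker_liftQ_eq_bot _ _ _ le_rfl)
  let : TopologicalSpace W := TopologicalSpace.induced T inferInstance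
  have hind : Topology.IsInducing T := ⟨rfl⟩
  have hemb : Topology.IsEmbedding T := ⟨hind, hT⟩
  exact ⟨W, inferInstance, inferInstance, inferInstance, hind.topologicalAddGroup T,
    hind.continuousSMul continuous_id (map_smul T _ _), hemb.t2Space, T,
    fun x => Submodule.Quotient.mk (Finsupp.single x 1), hemb,
    fun x => (Submodule.liftQ_apply _ p _).trans (by simp [p])⟩

theorem exists_oneParameter_valuation {V A : Type*} [NormedAddCommGroup V] [NormedSpace ℝ V]
    [FiniteDimensional ℝ V] [AddCommGroup A] [TopologicalSpace A] [IsTopologicalAddGroup A]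
    [T2Space A] {φ : C(ConvexBody V, A)} (hφ : ConvexBody.IsValuation φ)
    (hinv : ConvexBody.IsTranslationInvariant φ) :
    ∃ f : ConvexBody V → (ℝ →ₜ+ A), Continuous f ∧ ConvexBody.IsValuation f ∧
      ConvexBody.IsTranslationInvariant f ∧ ∀ X, f X 1 = φ X - φ (ConvexBody.point 0) := by
  obtain ⟨Φ, hΦ⟩ := exists_oneParameter_apply_one (A := A) (finrank ℝ V)
  let r (X : ConvexBody V) : contPolynomialLT A (finrank ℝ V + 1) :=
    ⟨ray φ X, ray_mem_contPolynomialLT hφ hinv X⟩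
  have hr : ConvexBody.IsValuation r :=
    isValuation_of_comp (γ := AddSubgroup.subtype _) Subtype.val_injective (isValuation_ray hφ)
  have hrinv : ConvexBody.IsTranslationInvariant r :=
    (isTranslationInvariant_comp_iff Subtype.val_injective).1 (isTranslationInvariant_ray hinv)
  refine ⟨fun X => Φ (r X), Φ.continuous_toFun.comp ((continuous_ray φ).subtype_mk _),
    isValuation_comp hr Φ.toAddMonoidHom, fun x K => congrArg Φ (hrinv x K), fun X => ?_⟩
  have h0 : (0 : ConvexBody V) = ConvexBody.point 0 := ConvexBody.ext rfl
  change Φ (r X) 1 = _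
  rw [hΦ]
  change φ ((1 : ℝ≥0) • X) - φ ((0 : ℝ≥0) • X) = _
  rw [one_smul, zero_smul, h0]

theorem theoremA {V : Type u} [NormedAddCommGroup V] [NormedSpace ℝ V]
    [FiniteDimensional ℝ V]
    {A : Type v} [AddCommGroup A] [TopologicalSpace A] [IsTopologicalAddGroup A] [T2Space A]
    (φ : ConvexBody V → A) (hcont : Continuous φ) (hval : ConvexBody.IsValuation φ)
    (hinv : ConvexBody.IsTranslationInvariant φ) :
    ∃ c : A, (∀ x : V, φ (ConvexBody.point x) = c) ∧
      ∃ (W : Type u) (_ : AddCommGroup W) (_ : Module ℝ W) (_ : TopologicalSpace W)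
        (_ : IsTopologicalAddGroup W) (_ : ContinuousSMul ℝ W) (_ : T2Space W)
        (f : ConvexBody V → W) (g : W →ₜ+ A),
        Continuous f ∧ ConvexBody.IsValuation f ∧ ConvexBody.IsTranslationInvariant f ∧
          ∀ X : ConvexBody V, φ X - c = g (f X) := by
  refine ⟨φ (ConvexBody.point 0), apply_point_eq_apply_zero hinv, ?_⟩
  obtain ⟨Γ, hΓcont, hΓval, hΓinv, hΓ⟩ :=
    exists_oneParameter_valuation (φ := ⟨φ, hcont⟩) hval hinv
  obtain ⟨W, _, _, _, _, _, _, T, f, hT, hTf⟩ := exists_small_topologicalVectorSpace Γ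
  obtain rfl : (fun X => T (f X)) = Γ := funext hTf
  let evalOne : (ℝ →ₜ+ A) →ₜ+ A := ⟨⟨⟨fun γ => γ 1, rfl⟩, fun _ _ => rfl⟩, continuous_eval_const 1⟩
  exact ⟨W, inferInstance, inferInstance, inferInstance, inferInstance, inferInstance,
    inferInstance, f, evalOne.comp ⟨T.toAddMonoidHom, hT.continuous⟩, hT.continuous_iff.2 hΓcont,
    isValuation_of_comp (γ := T.toAddMonoidHom) hT.injective hΓval,
    (isTranslationInvariant_comp_iff hT.injective).1 hΓinv, fun X => (hΓ X).symm⟩
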